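/- Let $k\ge 1$, $m\ge 2$, $n\ge 0$, and let $H_1,\dots,H_k$ be cliques, $H_i=K_{r_i}$ with $r_i\ge 1$. For graphs $H,G$ let $\mathcal N(H,G)$ be the number of (not necessarily induced) subgraphs of $G$ isomorphic to $H$. For a graph $G$ whose edges are colored with colors $1,\dots,k$ (arbitrarily, so adjacent edges may share a color), let $G_i$ be the spanning subgraph of $G$ formed by the edges of color $i$, and put $$\mathcal N^{\mathrm{col}}(H_1,\dots,H_k;G)=\sum_{i=1}^k\mathcal N(H_i,G_i).$$ Let $T_{m-1}(n)$ be the Turán graph: the complete $(m-1)$-partite graph on $n$ vertices whose parts have sizes $\lfloor n/(m-1)\rfloor$ or $\lceil n/(m-1)\rceil$. Then, for every $n$, among all $k$-edge-colored $K_m$-free graphs $G$ on $n$ vertices, the quantity $\mathcal N^{\mathrm{col}}(H_1,\dots,H_k;G)$ is maximized by a monochromatic $T_{m-1}(n)$: there is a color $i$ such that $T_{m-1}(n)$, which is $K_m$-free, attains the maximum when all its edges are given color $i$. If moreover every $r_i\ge 2$, then the tuple $(H_1,\dots,H_k,K_m)$ is color-resistant for every $n$, i.e. $$\mathrm{ex}^{\mathrm{col}}(n,(H_1,\dots,H_k),K_m)=\max_{1\le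 i\le k}\mathrm{ex}(n,H_i,K_m),$$ where $\mathrm{ex}^{\mathrm{col}}(n,(H_1,\dots,H_k),K_m)$ is the largest value of $\mathcal N^{\mathrm{col}}(H_1,\dots,H_k;G)$ over $k$-edge-colored $K_m$-free graphs $G$ on $n$ vertices, and $\mathrm{ex}(n,H_i,K_m)$ is the largest value of $\mathcal N(H_i,G)$ over (uncolored) $K_m$-free graphs $G$ on $n$ vertices. -/

import Mathlib

namespace ColoredTuran

open SimpleGraph

universe u v w

/-- `N^col(H₁, …, H_k; G)`: the sum over the colors `i` of the number of (not necessarily induced)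
subgraphs isomorphic to `H i` of the spanning subgraph `G_i` formed by the edges of color `i`. -/
noncomputable def coloredCount {k : ℕ} {W : Fin k → Type w} (H : ∀ i, SimpleGraph (W i))
    {V : Type v} [Fintype V] {G : SimpleGraph V} (c : G.EdgeLabeling (Fin k)) : ℕ :=
  ∑ i, (c.labelGraph i).copyCount (H i)

/-- The coloring of `G` in which every edge has color `i`. -/
def monochromatic {k : ℕ} {V : Type v} (G : SimpleGraph V) (i : Fin k) :
    G.EdgeLabeling (Fin k) :=
  fun _ => i

/-- The numbers of copies of `H` in `F`-free graphs on `n` vertices. -/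
def exValues (n : ℕ) {W : Type w} (H : SimpleGraph W) {U : Type u} (F : SimpleGraph U) : Set ℕ :=
  {x | ∃ G : SimpleGraph (Fin n), F.Free G ∧ G.copyCount H = x}

/-- `ex(n, H, F)`: the largest number of copies of `H` in an `F`-free graph on `n` vertices. -/
noncomputable def ex (n : ℕ) {W : Type w} (H : SimpleGraph W) {U : Type u} (F : SimpleGraph U) :
    ℕ :=
  sSup (exValues n H F)

/-- The values `N^col(H₁, …, H_k; G)` over `k`-edge-colored `F`-free graphs on `n` vertices. -/
def cexValues (n : ℕ) {k : ℕ} {W : Fin k → Type w} (H : ∀ i, SimpleGraph (W i))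
    {U : Type u} (F : SimpleGraph U) : Set ℕ :=
  {x | ∃ (G : SimpleGraph (Fin n)) (c : G.EdgeLabeling (Fin k)),
    F.Free G ∧ coloredCount H c = x}

/-- `ex^col(n, (H₁, …, H_k), F)`: the largest value of `N^col(H₁, …, H_k; G)` over
`k`-edge-colored `F`-free graphs `G` on `n` vertices. -/
noncomputable def cex (n : ℕ) {k : ℕ} {W : Fin k → Type w} (H : ∀ i, SimpleGraph (W i))
    {U : Type u} (F : SimpleGraph U) : ℕ :=
  sSup (cexValues n H F)

/-- Both sets of values are finite, so that the suprema above are maxima (of nonempty sets). -/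
theorem exValues_finite (n : ℕ) {W : Type w} (H : SimpleGraph W) {U : Type u}
    (F : SimpleGraph U) : (exValues n H F).Finite := by
  refine (Set.finite_range (fun G : SimpleGraph (Fin n) => G.copyCount H)).subset ?_
  rintro x ⟨G, -, rfl⟩
  exact ⟨G, rfl⟩

theorem cexValues_finite (n : ℕ) {k : ℕ} {W : Fin k → Type w} (H : ∀ i, SimpleGraph (W i))
    {U : Type u} (F : SimpleGraph U) : (cexValues n H F).Finite := by
  refine (Set.finite_range (fun p : Σ G : SimpleGraph (Fin n), G.EdgeLabeling (Fin k) =>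
    coloredCount H p.2)).subset ?_
  rintro x ⟨G, c, -, rfl⟩
  exact ⟨⟨G, c⟩, rfl⟩

/-- The tuple `(H₁, …, H_k, F)` is color-resistant for `n`:
`ex^col(n, (H₁, …, H_k), F) = max_{i ≤ k} ex(n, H_i, F)`. -/
def IsColorResistant (n : ℕ) {k : ℕ} {W : Fin k → Type w} (H : ∀ i, SimpleGraph (W i))
    {U : Type u} (F : SimpleGraph U) : Prop :=
  cex n H F = Finset.univ.sup (fun i => ex n (H i) F)

end ColoredTuran

/-!
Write `k_r` for the number of `r`-cliques and let `T` be the Turán graph on `n` vertices. For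
`r ≥ 2` a `K_{t+1}`-free graph `G` on `n` vertices has at most as many `r`-cliques per edge as `T`:
`k_r(G) * k_2(T) ≤ k_2(G) * k_r(T)`. Since the color classes share out at most `k_2(T)` edges,
summing this over the colors bounds the colored count by the largest `k_{r_i}(T)`.

The inequality says that `Φ = k_2(T) * k_r - k_r(T) * k_2` is nonpositive at `G`. Give each vertex
weight one and count cliques with the product of their weights. As no clique contains two
nonadjacent vertices, `Φ` is affine along transfers of weight between them, so the weight can be
moved onto a clique, of size at most `t`, without decreasing `Φ`. There `k_r` is the elementary
symmetric function `e_r` of the weights, and bringing two weights closer together increases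
`e_r / e_2` until the weights are the part sizes of `T`.
-/

namespace ColoredTuran

open Finset Function SimpleGraph

section ElementarySymmetric

variable {R : Type*} [CommSemiring R]

theorem esymm_zero_right (s : Multiset R) : s.esymm 0 = 1 := by
  simp [Multiset.esymm]

theorem esymm_cons_succ (a : R) (s : Multiset R) (q : ℕ) :
    (a ::ₘ s).esymm (q + 1) = s.esymm (q + 1) + a * s.esymm q := by
  simp [Multiset.esymm, Multiset.sum_map_mul_left]

theorem esymm_cons_cons (a b : R) (s : Multiset R) (q : ℕ) :
    (a ::ₘ b ::ₘ s).esymm (q + 2) =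
      s.esymm (q + 2) + (a + b) * s.esymm (q + 1) + a * b * s.esymm q := by
  simp only [esymm_cons_succ]
  ring

theorem esymm_add_replicate_zero (s : Multiset R) (c q : ℕ) :
    (s + Multiset.replicate c 0).esymm q = s.esymm q := by
  induction c with
  | zero => simp
  | succ c ih =>
    rw [Multiset.replicate_succ, Multiset.add_cons, ← ih]
    cases q <;> simp [esymm_zero_right, esymm_cons_succ]

variable [PartialOrder R] [IsOrderedRing R] [CanonicallyOrderedAdd R]

theorem esymm_add_le_mul (s : Multiset R) (p q : ℕ) :
    s.esymm (p + q) ≤ s.esymm p * s.esymm q := by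
  induction s using Multiset.induction_on generalizing p q with
  | empty => cases p <;> cases q <;>
      simp [Multiset.esymm, Multiset.powersetCard_zero_right, ← add_assoc]
  | cons a s ih =>
    obtain - | p := p
    · simp [esymm_zero_right]
    obtain - | q := q
    · simp [esymm_zero_right]
    calc (a ::ₘ s).esymm (p + 1 + (q + 1))
        = s.esymm (p + 1 + (q + 1)) + a * s.esymm (p + 1 + q) := esymm_cons_succ a s (p + 1 + q)
      _ ≤ s.esymm (p + 1) * s.esymm (q + 1) + a * (s.esymm (p + 1) * s.esymm q) := by
          gcongr <;> exact ih _ _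
      _ ≤ s.esymm (p + 1) * s.esymm (q + 1) + a * (s.esymm (p + 1) * s.esymm q) +
            a * s.esymm p * (s.esymm (q + 1) + a * s.esymm q) := le_self_add
      _ = (a ::ₘ s).esymm (p + 1) * (a ::ₘ s).esymm (q + 1) := by
          simp only [esymm_cons_succ]
          ring

theorem esymm_mul_esymm_two_le_of_mul_le (s : Multiset R) {a b c d : R} (hadd : a + b = c + d)
    (hmul : a * b ≤ c * d) (q : ℕ) :
    (a ::ₘ b ::ₘ s).esymm (q + 2) * (c ::ₘ d ::ₘ s).esymm 2 ≤
      (a ::ₘ b ::ₘ s).esymm 2 * (c ::ₘ d ::ₘ s).esymm (q + 2) := by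
  obtain ⟨w, hw⟩ := exists_add_of_le hmul
  -- The parts of `e_{q+2}` and `e_2` that are the same for `(a, b)` and `(c, d)`.
  set X := s.esymm (q + 2) + (c + d) * s.esymm (q + 1) with hX
  set Y := s.esymm 2 + (c + d) * s.esymm 1 with hY
  have hXY : X ≤ s.esymm q * Y := by
    calc X ≤ s.esymm q * s.esymm 2 + (c + d) * (s.esymm q * s.esymm 1) := by
          rw [hX]
          gcongr <;> exact esymm_add_le_mul s _ _
      _ = s.esymm q * Y := by rw [hY]; ring
  simp only [esymm_cons_cons _ _ s q, esymm_cons_cons _ _ s 0, zero_add, esymm_zero_right, mul_one,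
    hadd, hw, ← hX, ← hY]
  calc (X + a * b * s.esymm q) * (Y + (a * b + w))
      = (X * Y + a * b * X + a * b * s.esymm q * (Y + (a * b + w))) + w * X := by ring
    _ ≤ (X * Y + a * b * X + a * b * s.esymm q * (Y + (a * b + w))) + w * (s.esymm q * Y) := by
        gcongr
    _ = (Y + a * b) * (X + (a * b + w) * s.esymm q) := by ring

end ElementarySymmetric

section Equitable

theorem eq_div_or_eq_div_add_one_of_equitableOn {s : Multiset ℕ}
    (hs : {x | x ∈ s}.EquitableOn id) {x : ℕ} (hx : x ∈ s) :
    x = s.sum / s.card ∨ x = s.sum / s.card + 1 := by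
  have hs' : ((univ : Finset s) : Set s).EquitableOn (fun y => (y : ℕ)) :=
    fun y z _ _ => hs Multiset.coe_mem Multiset.coe_mem
  have hsum : ∑ y : s, (y : ℕ) = s.sum := congrArg Multiset.sum s.map_univ_coe
  simpa [hsum] using
    equitableOn_iff.1 hs' (s.mkToType x ⟨0, Multiset.count_pos.2 hx⟩) (mem_univ _)

theorem exists_eq_replicate_add_replicate {α : Type*} {s : Multiset α} {a b : α}
    (hs : ∀ x ∈ s, x = a ∨ x = b) :
    ∃ p q, s = Multiset.replicate p a + Multiset.replicate q b := by
  induction s using Multiset.induction_on with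
  | empty => exact ⟨0, 0, rfl⟩
  | cons x s ih =>
    obtain ⟨p, q, rfl⟩ := ih fun y hy => hs y (Multiset.mem_cons_of_mem hy)
    obtain rfl | rfl := hs x (Multiset.mem_cons_self x _)
    · exact ⟨p + 1, q, by rw [Multiset.replicate_succ, Multiset.cons_add]⟩
    · exact ⟨p, q + 1, by rw [Multiset.replicate_succ, Multiset.add_cons]⟩

theorem eq_of_equitableOn_of_card_eq_of_sum_eq {s u : Multiset ℕ}
    (hs : {x | x ∈ s}.EquitableOn id) (hu : {x | x ∈ u}.EquitableOn id)
    (hcard : s.card = u.card) (hsum : s.sum = u.sum) : s = u := by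
  obtain ⟨p, q, hpq⟩ := exists_eq_replicate_add_replicate fun x hx =>
    eq_div_or_eq_div_add_one_of_equitableOn hs hx
  obtain ⟨p', q', hpq'⟩ := exists_eq_replicate_add_replicate fun x hx =>
    eq_div_or_eq_div_add_one_of_equitableOn hu hx
  rw [← hcard, ← hsum] at hpq'
  generalize s.sum / s.card = d at hpq hpq'
  subst hpq hpq'
  simp only [Multiset.card_add, Multiset.card_replicate, Multiset.sum_add,
    Multiset.sum_replicate, smul_eq_mul] at hcard hsum
  have hq : q = q' := by nlinarith
  rw [hq, show p = p' by omega]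

theorem esymm_mul_esymm_two_le_of_equitableOn {s u : Multiset ℕ}
    (hu : {x | x ∈ u}.EquitableOn id) (hcard : s.card = u.card) (hsum : s.sum = u.sum) (q : ℕ) :
    s.esymm (q + 2) * u.esymm 2 ≤ s.esymm 2 * u.esymm (q + 2) := by
  induction hN : (s.map (· ^ 2)).sum using Nat.strong_induction_on generalizing s with
  | _ N ih =>
    by_cases hs : {x | x ∈ s}.EquitableOn id
    · rw [eq_of_equitableOn_of_card_eq_of_sum_eq hs hu hcard hsum, mul_comm]
    obtain ⟨x, hx, y, hy, hyx⟩ := Set.not_equitableOn.1 hs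
    obtain ⟨z, rfl⟩ : ∃ z, x = y + z + 2 := Nat.exists_eq_add_of_lt hyx |>.imp fun z hz => by
      simp only [id_eq] at hz
      omega
    obtain ⟨s, rfl⟩ := Multiset.exists_cons_of_mem hx
    obtain ⟨s, rfl⟩ :=
      Multiset.exists_cons_of_mem ((Multiset.mem_cons.1 hy).resolve_left (by omega))
    set s' := (y + z + 1) ::ₘ (y + 1) ::ₘ s with hs'
    have hlt : (s'.map (· ^ 2)).sum < N := by
      simp only [← hN, hs', Multiset.map_cons, Multiset.sum_cons]
      have hsq : (y + z + 2) ^ 2 + y ^ 2 = (y + z + 1) ^ 2 + (y + 1) ^ 2 + (2 * z + 2) := by ring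
      omega
    have hs'u := ih _ hlt (by simpa [hs'] using hcard)
      (by rw [← hsum]; simp only [hs', Multiset.sum_cons]; ring) rfl
    have hss' := esymm_mul_esymm_two_le_of_mul_le s
      (show (y + z + 2) + y = (y + z + 1) + (y + 1) by ring) (by nlinarith) q
    have hpos : 0 < s'.esymm 2 := by
      rw [hs', esymm_cons_cons _ _ _ 0, esymm_zero_right]
      positivity
    refine Nat.le_of_mul_le_mul_right ?_ hpos
    set s := (y + z + 2) ::ₘ y ::ₘ s
    calc s.esymm (q + 2) * u.esymm 2 * s'.esymm 2
        = s.esymm (q + 2) * s'.esymm 2 * u.esymm 2 := by ring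
      _ ≤ s.esymm 2 * s'.esymm (q + 2) * u.esymm 2 := by gcongr
      _ = s.esymm 2 * (s'.esymm (q + 2) * u.esymm 2) := by ring
      _ ≤ s.esymm 2 * (s'.esymm 2 * u.esymm (q + 2)) := by gcongr
      _ = s.esymm 2 * u.esymm (q + 2) * s'.esymm 2 := by ring

end Equitable

section MoveWeight

variable {V M : Type*} [DecidableEq V]

/-- The weight function obtained from `x` by moving all the weight of `v` to `u`: one step of
Zykov's symmetrization. It is meant for `u ≠ v`. -/
def moveWeight [AddZeroClass M] (x : V → M) (u v : V) : V → M :=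
  update (update x v 0) u (x u + x v)

theorem sum_moveWeight [Fintype V] [AddCommMonoid M] (x : V → M) {u v : V} (huv : u ≠ v) :
    ∑ w, moveWeight x u v w = ∑ w, x w := by
  have hv : v ∈ univ.erase u := mem_erase.2 ⟨huv.symm, mem_univ v⟩
  rw [moveWeight, sum_update_of_mem (mem_univ u), sdiff_singleton_eq_erase, sum_update_of_mem hv,
    sdiff_singleton_eq_erase, zero_add, add_assoc, add_sum_erase _ _ hv,
    add_sum_erase _ _ (mem_univ u)]

theorem prod_moveWeight_of_mem_of_notMem [CommSemiring M] (x : V → M) {u v : V} {S : Finset V}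
    (hu : u ∈ S) (hv : v ∉ S) :
    ∏ w ∈ S, moveWeight x u v w = (x u + x v) * ∏ w ∈ S.erase u, x w := by
  rw [moveWeight, prod_update_of_mem hu, sdiff_singleton_eq_erase,
    prod_update_of_notMem fun h => hv (mem_of_mem_erase h)]

theorem prod_moveWeight_eq_zero [CommSemiring M] (x : V → M) {u v : V} (huv : u ≠ v)
    {S : Finset V} (hv : v ∈ S) : ∏ w ∈ S, moveWeight x u v w = 0 :=
  prod_eq_zero hv (by simp [moveWeight, huv.symm])

theorem prod_moveWeight_of_notMem [CommSemiring M] (x : V → M) {u v : V} {S : Finset V}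
    (hu : u ∉ S) (hv : v ∉ S) : ∏ w ∈ S, moveWeight x u v w = ∏ w ∈ S, x w := by
  rw [moveWeight, prod_update_of_notMem hu, prod_update_of_notMem hv]

theorem support_moveWeight_ssubset [AddZeroClass M] (x : V → M) {u v : V} (huv : u ≠ v)
    (hu : x u ≠ 0) (hv : x v ≠ 0) : support (moveWeight x u v) ⊂ support x := by
  refine Set.ssubset_iff_of_subset (fun w hw => ?_) |>.2 ⟨v, hv, ?_⟩
  · by_cases hwu : w = u
    · exact hwu ▸ hu
    by_cases hwv : w = v
    · exact hwv ▸ hv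
    simpa [moveWeight, hwu, hwv] using hw
  · simp [moveWeight, huv.symm]

theorem exists_isClique_support_le [Fintype V] [AddCommMonoid M] {α : Type*} [Preorder α]
    (G : SimpleGraph V) (Φ : (V → M) → α)
    (hΦ : ∀ x u v, u ≠ v → ¬G.Adj u v → x u ≠ 0 → x v ≠ 0 →
      Φ x ≤ Φ (moveWeight x u v) ∨ Φ x ≤ Φ (moveWeight x v u)) (x : V → M) :
    ∃ y : V → M, ∑ w, y w = ∑ w, x w ∧ G.IsClique (support y) ∧ Φ x ≤ Φ y := by
  induction hN : (support x).ncard using Nat.strong_induction_on generalizing x with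
  | _ N ih =>
    by_cases hcl : G.IsClique (support x)
    · exact ⟨x, rfl, hcl, le_rfl⟩
    simp only [isClique_iff, Set.Pairwise, not_forall] at hcl
    obtain ⟨u, hu, v, hv, huv, hadj⟩ := hcl
    wlog hle : Φ x ≤ Φ (moveWeight x u v) generalizing u v
    · exact this v hv u hu huv.symm (fun h => hadj h.symm)
        ((hΦ x u v huv hadj hu hv).resolve_left hle)
    have hlt : (support (moveWeight x u v)).ncard < N :=
      hN ▸ Set.ncard_lt_ncard (support_moveWeight_ssubset x huv hu hv)
    obtain ⟨y, hsum, hy, hle'⟩ := ih _ hlt _ rfl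
    exact ⟨y, hsum.trans (sum_moveWeight x huv), hy, hle.trans hle'⟩

end MoveWeight

section WeightedCliqueCount

variable {V R : Type*} [Fintype V] [DecidableEq V] [CommSemiring R] (G : SimpleGraph V)
  [DecidableRel G.Adj]

/-- The number of `r`-cliques of `G`, each counted with the product of its vertex weights. For
natural weights this is the number of `r`-cliques of the blow-up of `G` in which each vertex `v`
becomes an independent set of `x v` vertices. -/
def weightedCliqueCount (r : ℕ) (x : V → R) : R :=
  ∑ S ∈ G.cliqueFinset r, ∏ v ∈ S, x v

theorem weightedCliqueCount_one (r : ℕ) :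
    weightedCliqueCount G r (fun _ => (1 : R)) = #(G.cliqueFinset r) := by
  simp [weightedCliqueCount]

theorem add_mul_weightedCliqueCount_eq (r : ℕ) (x : V → R) {u v : V} (huv : u ≠ v)
    (hadj : ¬G.Adj u v) :
    (x u + x v) * weightedCliqueCount G r x =
      x u * weightedCliqueCount G r (moveWeight x u v) +
        x v * weightedCliqueCount G r (moveWeight x v u) := by
  simp only [weightedCliqueCount, mul_sum, ← sum_add_distrib]
  refine sum_congr rfl fun S hS => ?_
  have hS := (G.mem_cliqueFinset_iff.1 hS).isClique
  by_cases hu : u ∈ S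
  · have hv : v ∉ S := fun hv => hadj (hS hu hv huv)
    rw [prod_moveWeight_of_mem_of_notMem x hu hv, prod_moveWeight_eq_zero x huv.symm hu,
      ← mul_prod_erase S x hu]
    ring
  by_cases hv : v ∈ S
  · rw [prod_moveWeight_of_mem_of_notMem x hv hu, prod_moveWeight_eq_zero x huv hv,
      ← mul_prod_erase S x hv]
    ring
  · rw [prod_moveWeight_of_notMem x hu hv, prod_moveWeight_of_notMem x hv hu, add_mul]

theorem weightedCliqueCount_eq_esymm (r : ℕ) {S : Finset V} (hS : G.IsClique S) {y : V → R}
    (hy : support y ⊆ S) : weightedCliqueCount G r y = (S.val.map y).esymm r := by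
  rw [Finset.esymm_map_val, weightedCliqueCount]
  refine (sum_subset (fun U hU => ?_) fun U hU hUS => ?_).symm
  · rw [mem_powersetCard] at hU
    exact G.mem_cliqueFinset_iff.2 ⟨hS.subset (coe_subset.2 hU.1), hU.2⟩
  · have hcard := (G.mem_cliqueFinset_iff.1 hU).card_eq
    obtain ⟨v, hvU, hvS⟩ := not_subset.1 fun h => hUS (mem_powersetCard.2 ⟨h, hcard⟩)
    exact prod_eq_zero hvU (notMem_support.1 fun h => hvS (hy h))

variable {G}

theorem weightedCliqueCount_mul_esymm_two_le_of_isClique {u : Multiset ℕ}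
    (hu : {x | x ∈ u}.EquitableOn id) {S : Finset V} (hS : G.IsClique S) (hcard : #S ≤ u.card)
    {y : V → ℕ} (hy : support y ⊆ S) (hsum : ∑ v, y v = u.sum) (q : ℕ) :
    weightedCliqueCount G (q + 2) y * u.esymm 2 ≤
      weightedCliqueCount G 2 y * u.esymm (q + 2) := by
  have hsumS : ∑ v ∈ S, y v = u.sum := by
    rw [← hsum]
    exact sum_subset (subset_univ S) fun v _ hv => notMem_support.1 fun h => hv (hy h)
  have h := esymm_mul_esymm_two_le_of_equitableOn
    (s := S.val.map y + Multiset.replicate (u.card - #S) 0) hu (by simp [hcard])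
    (by rw [Multiset.sum_add, Multiset.sum_replicate, smul_zero, add_zero]; exact hsumS) q
  simpa only [esymm_add_replicate_zero, ← weightedCliqueCount_eq_esymm G _ hS hy] using h

theorem card_cliqueFinset_mul_esymm_two_le {t : ℕ} (hG : G.CliqueFree (t + 1)) {u : Multiset ℕ}
    (hu : {x | x ∈ u}.EquitableOn id) (hcard : u.card = t) (hsum : u.sum = Fintype.card V)
    (q : ℕ) :
    #(G.cliqueFinset (q + 2)) * u.esymm 2 ≤ #(G.cliqueFinset 2) * u.esymm (q + 2) := by
  let Φ (x : V → ℕ) : ℤ := u.esymm 2 * weightedCliqueCount G (q + 2) x -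
    u.esymm (q + 2) * weightedCliqueCount G 2 x
  have hΦ (x : V → ℕ) (v w : V) (hvw : v ≠ w) (hadj : ¬G.Adj v w) (hv : x v ≠ 0) (_ : x w ≠ 0) :
      Φ x ≤ Φ (moveWeight x v w) ∨ Φ x ≤ Φ (moveWeight x w v) := by
    have hmean : (x v + x w : ℤ) * Φ x =
        x v * Φ (moveWeight x v w) + x w * Φ (moveWeight x w v) := by
      have h₁ := add_mul_weightedCliqueCount_eq G (q + 2) x hvw hadj
      have h₂ := add_mul_weightedCliqueCount_eq G 2 x hvw hadj
      zify at h₁ h₂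
      linear_combination (u.esymm 2 : ℤ) * h₁ - (u.esymm (q + 2) : ℤ) * h₂
    have hv' : (0 : ℤ) < x v := by positivity
    by_contra! hlt
    nlinarith
  obtain ⟨y, hy, hcl, hle⟩ := exists_isClique_support_le G Φ hΦ fun _ => 1
  obtain ⟨S, hS⟩ := (Set.toFinite (support y)).exists_finset_coe
  rw [← hS] at hcl
  have hSt : #S ≤ u.card := by
    by_contra! h
    exact hG.mono (hcard ▸ h) S ⟨hcl, rfl⟩
  have hΦy := weightedCliqueCount_mul_esymm_two_le_of_isClique hu hcl hSt hS.ge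
    (by rw [hy, hsum, sum_const, card_univ, smul_eq_mul, mul_one]) q
  simp only [Φ, weightedCliqueCount_one] at hle
  zify at hΦy ⊢
  push_cast at hle
  linarith

end WeightedCliqueCount

section TuranGraph

theorem card_filter_bijOn {V W : Type*} [Fintype V] (f : V → W) (S : Finset W) [DecidableEq W]
    [DecidablePred fun U : Finset V => Set.BijOn f U S] :
    #{U : Finset V | Set.BijOn f U S} = ∏ w ∈ S, #{v | f v = w} := by
  classical
  rw [← prod_coe_sort, ← Fintype.card_piFinset]
  symm
  have hf {p : S → V} (hp : p ∈ Fintype.piFinset fun w : S => {v | f v = w}) (w : S) :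
      f (p w) = w := by simpa using Fintype.mem_piFinset.1 hp w
  refine card_bij (fun p _ => univ.image p) (fun p hp => ?_) (fun p hp p' hp' h => ?_)
    fun U hU => ?_
  · simp only [mem_filter_univ, coe_image, coe_univ, Set.image_univ]
    refine ⟨?_, ?_, fun w hw => ⟨p ⟨w, hw⟩, Set.mem_range_self _, hf hp ⟨w, hw⟩⟩⟩
    · rintro _ ⟨w, rfl⟩
      exact hf hp w ▸ w.2
    · rintro _ ⟨w, rfl⟩ _ ⟨w', rfl⟩ h
      rw [hf hp, hf hp, Subtype.coe_inj] at h
      rw [h]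
  · ext w
    obtain ⟨w', -, hw'⟩ := mem_image.1 (h ▸ mem_image_of_mem p (mem_univ w))
    rw [← hw', show w = w' from Subtype.ext (by rw [← hf hp w, ← hw', hf hp' w'])]
  · have hU : Set.BijOn f U S := by simpa using hU
    choose p hpU hp using fun w : S => hU.surjOn w.2
    refine ⟨p, by simpa using hp, ?_⟩
    ext v
    simp only [mem_image, mem_univ, true_and]
    constructor
    · rintro ⟨w, rfl⟩
      exact hpU w
    · exact fun hv => ⟨⟨f v, hU.mapsTo hv⟩, hU.injOn (hpU _) hv (hp _)⟩

theorem card_cliqueFinset_comap {V W : Type*} [Fintype V] [DecidableEq V] [Fintype W]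
    [DecidableEq W] (G : SimpleGraph W) [DecidableRel G.Adj] (f : V → W)
    [DecidableRel (G.comap f).Adj] (r : ℕ) :
    #((G.comap f).cliqueFinset r) = weightedCliqueCount G r fun w => #{v | f v = w} := by
  classical
  have hinj {U : Finset V} (hU : (G.comap f).IsClique U) : Set.InjOn f U := fun v hv w hw h =>
    by_contra fun hvw => G.ne_of_adj (hU hv hw hvw) h
  have himage : ∀ U ∈ (G.comap f).cliqueFinset r, U.image f ∈ G.cliqueFinset r := fun U hU => by
    rw [mem_cliqueFinset_iff] at hU ⊢
    refine ⟨?_, (card_image_of_injOn (hinj hU.isClique)).trans hU.card_eq⟩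
    rw [coe_image]
    rintro _ ⟨v, hv, rfl⟩ _ ⟨w, hw, rfl⟩ h
    exact hU.isClique hv hw (ne_of_apply_ne f h)
  rw [card_eq_sum_card_fiberwise himage, weightedCliqueCount]
  refine sum_congr rfl fun S hS => ?_
  rw [← card_filter_bijOn]
  have hS := G.mem_cliqueFinset_iff.1 hS
  congr 1
  ext U
  simp only [mem_filter, mem_univ, true_and, mem_cliqueFinset_iff]
  constructor
  · rintro ⟨hU, rfl⟩
    rw [coe_image]
    exact (hinj hU.isClique).bijOn_image
  · refine fun hU => ⟨⟨fun v hv w hw h => ?_, ?_⟩, ?_⟩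
    · exact hS.isClique (hU.mapsTo hv) (hU.mapsTo hw) (hU.injOn.ne hv hw h)
    · rw [← hS.card_eq, ← coe_injective (coe_image.trans hU.image_eq), card_image_of_injOn hU.injOn]
    · exact coe_injective (coe_image.trans hU.image_eq)

/-- The sizes of the residue classes modulo `t` in `{0, …, n - 1}`, which are the parts of
`turanGraph n t`. -/
def turanPartSizes (n t : ℕ) : Multiset ℕ :=
  (univ : Finset (Fin t)).val.map fun i : Fin t => #{v : Fin n | (v : ℕ) % t = i}

theorem card_turanPartSizes (n t : ℕ) : (turanPartSizes n t).card = t := by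
  simp [turanPartSizes]

theorem sum_turanPartSizes (n : ℕ) {t : ℕ} (ht : 0 < t) : (turanPartSizes n t).sum = n := by
  have h := card_eq_sum_card_fiberwise (s := (univ : Finset (Fin n)))
    (t := (univ : Finset (Fin t))) (f := fun v => ⟨v % t, Nat.mod_lt _ ht⟩) fun _ _ => mem_univ _
  simp only [card_univ, Fintype.card_fin, Fin.ext_iff] at h
  exact h.symm

theorem equitableOn_turanPartSizes (n t : ℕ) : {x | x ∈ turanPartSizes n t}.EquitableOn id := by
  refine Set.equitableOn_iff_exists_le_le_add_one.2 ⟨n / t, fun x hx => ?_⟩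
  rw [turanPartSizes, Set.mem_ofPred_eq, Multiset.mem_map] at hx
  obtain ⟨i, -, rfl⟩ := hx
  have hcount : #{v : Fin n | (v : ℕ) % t = i} = n.count (· ≡ i [MOD t]) := by
    rw [Nat.count_eq_card_filter_range, range_eq_Ico, ← card_map Fin.valEmbedding]
    congr 1
    ext v
    simp [Nat.ModEq, Nat.mod_eq_of_lt i.2, Fin.exists_iff, and_comm]
  rw [id_eq, hcount, Nat.count_modEq_card n i.pos i]
  split_ifs <;> omega

theorem card_cliqueFinset_turanGraph (n r : ℕ) {t : ℕ} (ht : 0 < t) :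
    #((turanGraph n t).cliqueFinset r) = (turanPartSizes n t).esymm r := by
  let f (v : Fin n) : Fin t := ⟨v % t, Nat.mod_lt _ ht⟩
  have hcomap : turanGraph n t = (⊤ : SimpleGraph (Fin t)).comap f := by
    ext v w
    simp [f, turanGraph_adj]
  have hclique : (⊤ : SimpleGraph (Fin t)).IsClique ((univ : Finset (Fin t)) : Set (Fin t)) :=
    fun _ _ _ _ h => h
  simp only [hcomap]
  rw [card_cliqueFinset_comap, weightedCliqueCount_eq_esymm _ r hclique (by simp)]
  simp only [f, Fin.ext_iff, turanPartSizes]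

end TuranGraph

section CliquesPerEdge

variable {V K : Type*} [Fintype V] [DecidableEq K] {G : SimpleGraph V} [DecidableRel G.Adj]

theorem card_edgeFinset_le_turanGraph {n t : ℕ} (hV : Fintype.card V = n)
    (hG : G.CliqueFree (t + 1)) : #G.edgeFinset ≤ #(turanGraph n t).edgeFinset := by
  subst hV
  exact hG.card_edgeFinset_le.trans_eq card_edgeFinset_turanGraph.symm

theorem sum_card_edgeFinset_labelGraph_le (c : G.EdgeLabeling K) (s : Finset K) :
    ∑ j ∈ s, #(c.labelGraph j).edgeFinset ≤ #G.edgeFinset := by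
  classical
  rw [← card_biUnion fun i _ j _ hij => disjoint_edgeFinset.2 (c.pairwise_disjoint_labelGraph hij)]
  exact card_le_card (biUnion_subset.2 fun j _ => edgeFinset_mono c.labelGraph_le)

variable [DecidableEq V]

theorem card_cliqueFinset_two (G : SimpleGraph V) [DecidableRel G.Adj] :
    #(G.cliqueFinset 2) = #G.edgeFinset := by
  symm
  refine card_bij (fun e _ => e.toFinset) (fun e he => ?_) (fun e _ e' _ h => ?_) fun S hS => ?_
  · induction e with
    | _ u v =>
      have huv : G.Adj u v := by simpa using he
      rw [Sym2.toFinset_mk_eq, mem_cliqueFinset_iff, isNClique_iff, card_pair huv.ne]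
      simp [huv]
  · exact Sym2.ext fun v => by rw [← Sym2.mem_toFinset, h, Sym2.mem_toFinset]
  · rw [mem_cliqueFinset_iff, isNClique_iff, card_eq_two] at hS
    obtain ⟨hS, u, v, huv, rfl⟩ := hS
    refine ⟨s(u, v), mem_edgeFinset.2 ?_, Sym2.toFinset_mk_eq⟩
    exact hS (by simp) (by simp) huv

theorem card_cliqueFinset_of_le_one (G : SimpleGraph V) [DecidableRel G.Adj] {r : ℕ}
    (hr : r ≤ 1) : #(G.cliqueFinset r) = (Fintype.card V).choose r := by
  rw [← card_univ, ← card_powersetCard]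
  congr 1
  ext S
  rw [mem_cliqueFinset_iff, isNClique_iff, mem_powersetCard_univ, and_iff_right_iff_imp]
  intro hS
  exact (card_le_one_iff_subsingleton.1 (hS.trans_le hr)).pairwise _

theorem card_cliqueFinset_mul_card_edgeFinset_turanGraph_le {n t : ℕ} (hV : Fintype.card V = n)
    (ht : 0 < t) (hG : G.CliqueFree (t + 1)) {r : ℕ} (hr : 2 ≤ r) :
    #(G.cliqueFinset r) * #(turanGraph n t).edgeFinset ≤
      #G.edgeFinset * #((turanGraph n t).cliqueFinset r) := by
  obtain ⟨q, rfl⟩ := Nat.exists_eq_add_of_le' hr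
  simp only [← card_cliqueFinset_two, card_cliqueFinset_turanGraph _ _ ht]
  exact card_cliqueFinset_mul_esymm_two_le hG (equitableOn_turanPartSizes _ t)
    (card_turanPartSizes n t) ((sum_turanPartSizes n ht).trans hV.symm) q

theorem sum_card_cliqueFinset_labelGraph_le {n t : ℕ} (hV : Fintype.card V = n) (ht : 0 < t)
    (hG : G.CliqueFree (t + 1)) (c : G.EdgeLabeling K) {s : Finset K} {r : K → ℕ}
    (hr : ∀ j ∈ s, 2 ≤ r j) {M : ℕ}
    (hM : ∀ j ∈ s, #((turanGraph n t).cliqueFinset (r j)) ≤ M) :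
    ∑ j ∈ s, #((c.labelGraph j).cliqueFinset (r j)) ≤ M := by
  have hedges :=
    (sum_card_edgeFinset_labelGraph_le c s).trans (card_edgeFinset_le_turanGraph hV hG)
  set e := #(turanGraph n t).edgeFinset
  obtain he | he := Nat.eq_zero_or_pos e
  · have hzero : ∑ j ∈ s, #((c.labelGraph j).cliqueFinset (r j)) = 0 := sum_eq_zero fun j hj => by
      have hj_edges : #(c.labelGraph j).edgeFinset = 0 :=
        sum_eq_zero_iff.1 (Nat.eq_zero_of_le_zero (he ▸ hedges)) j hj
      rw [← card_cliqueFinset_two, card_eq_zero, cliqueFinset_eq_empty_iff] at hj_edges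
      rw [card_eq_zero, cliqueFinset_eq_empty_iff]
      exact hj_edges.mono (hr j hj)
    exact hzero.trans_le M.zero_le
  refine Nat.le_of_mul_le_mul_right ?_ he
  calc (∑ j ∈ s, #((c.labelGraph j).cliqueFinset (r j))) * e
      = ∑ j ∈ s, #((c.labelGraph j).cliqueFinset (r j)) * e := sum_mul ..
    _ ≤ ∑ j ∈ s, #(c.labelGraph j).edgeFinset * M := sum_le_sum fun j hj =>
        (card_cliqueFinset_mul_card_edgeFinset_turanGraph_le hV ht
          (hG.anti c.labelGraph_le) (hr j hj)).trans (Nat.mul_le_mul_left _ (hM j hj))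
    _ = (∑ j ∈ s, #(c.labelGraph j).edgeFinset) * M := (sum_mul ..).symm
    _ ≤ e * M := Nat.mul_le_mul_right M hedges
    _ = M * e := mul_comm e M

end CliquesPerEdge

section ColoredCount

variable {V : Type*} {k n : ℕ}

theorem copyCount_completeGraph {W : Type*} [Fintype V] [Fintype W] [DecidableEq V]
    (G : SimpleGraph V) [DecidableRel G.Adj] :
    G.copyCount (completeGraph W) = #(G.cliqueFinset (Fintype.card W)) := by
  classical
  rw [copyCount]
  symm
  refine card_bij (fun S _ => (⊤ : G.Subgraph).induce S) (fun S hS => ?_) (fun S _ S' _ h => ?_)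
    fun G' hG' => ?_
  · have hS := G.mem_cliqueFinset_iff.1 hS
    have hcoe := (induce_eq_coe_induce_top (S : Set V)).symm.trans (induce_eq_top.2 hS.isClique)
    simp only [mem_filter, mem_univ, true_and]
    exact hcoe.symm ▸ ⟨Iso.completeGraph (Fintype.equivOfCardEq (by simp [hS.card_eq]))⟩
  · exact coe_injective (congrArg Subgraph.verts h)
  · simp only [mem_filter, mem_univ, true_and] at hG'
    obtain ⟨e⟩ := hG'
    have hadj {v w : V} (hv : v ∈ G'.verts) (hw : w ∈ G'.verts) (hvw : v ≠ w) : G'.Adj v w := by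
      have h : (completeGraph W).Adj (e.symm ⟨v, hv⟩) (e.symm ⟨w, hw⟩) := by simpa using hvw
      exact e.symm.map_adj_iff.1 h
    refine ⟨G'.verts.toFinset, ?_, ?_⟩
    · rw [mem_cliqueFinset_iff, isNClique_iff, Set.coe_toFinset, Set.toFinset_card,
        Fintype.card_congr e.toEquiv]
      exact ⟨fun v hv w hw hvw => (hadj hv hw hvw).adj_sub, rfl⟩
    · rw [Set.coe_toFinset]
      exact Subgraph.IsInduced.induce_top_verts fun v hv w hw h => hadj hv hw h.ne

theorem labelGraph_monochromatic (G : SimpleGraph V) (i j : Fin k) :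
    (monochromatic G i).labelGraph j = if j = i then G else ⊥ := by
  ext u v
  rw [EdgeLabeling.labelGraph_adj]
  split_ifs with h
  · simp [monochromatic, h]
  · simp [monochromatic, Ne.symm h]

theorem coloredCount_monochromatic {W : Fin k → Type*} {H : ∀ i, SimpleGraph (W i)} [Fintype V]
    (hH : ∀ j, H j ≠ ⊥) (G : SimpleGraph V) (i : Fin k) :
    coloredCount H (monochromatic G i) = G.copyCount (H i) := by
  rw [coloredCount, sum_eq_single_of_mem i (mem_univ i) fun j _ hj => ?_, labelGraph_monochromatic,
    if_pos rfl]
  rw [labelGraph_monochromatic, if_neg hj, copyCount_eq_zero]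
  exact free_bot (hH j)

theorem exists_forall_coloredCount_le_monochromatic {t : ℕ} (hk : 1 ≤ k) (ht : 0 < t)
    (r : Fin k → ℕ) :
    ∃ i : Fin k, ∀ (G : SimpleGraph (Fin n)) (c : G.EdgeLabeling (Fin k)), G.CliqueFree (t + 1) →
      coloredCount (fun j => completeGraph (Fin (r j))) c ≤
        coloredCount (fun j => completeGraph (Fin (r j))) (monochromatic (turanGraph n t) i) := by
  classical
  have hsmall (G G' : SimpleGraph (Fin n)) (j : Fin k) (hj : ¬2 ≤ r j) :
      G.copyCount (completeGraph (Fin (r j))) = G'.copyCount (completeGraph (Fin (r j))) := by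
    simp only [copyCount_completeGraph, Fintype.card_fin]
    rw [card_cliqueFinset_of_le_one G (by omega), card_cliqueFinset_of_le_one G' (by omega)]
  obtain hs | hs := ({j | 2 ≤ r j} : Finset (Fin k)).eq_empty_or_nonempty
  · refine ⟨⟨0, hk⟩, fun G c _ => sum_le_sum fun j _ => (hsmall _ _ j ?_).le⟩
    exact filter_eq_empty_iff.1 hs (mem_univ j)
  obtain ⟨i, hi, hmax⟩ := exists_max_image _
    (fun j => (turanGraph n t).copyCount (completeGraph (Fin (r j)))) hs
  refine ⟨i, fun G c hG => ?_⟩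
  have hlarge : ∑ j with 2 ≤ r j, (c.labelGraph j).copyCount (completeGraph (Fin (r j))) ≤
      (turanGraph n t).copyCount (completeGraph (Fin (r i))) := by
    simp only [copyCount_completeGraph, Fintype.card_fin] at hmax ⊢
    exact sum_card_cliqueFinset_labelGraph_le (Fintype.card_fin n) ht hG c
      (fun j hj => (mem_filter.1 hj).2) hmax
  rw [coloredCount, coloredCount, ← sum_filter_add_sum_filter_not univ fun j => 2 ≤ r j,
    ← sum_filter_add_sum_filter_not univ (fun j => 2 ≤ r j) fun j =>
      ((monochromatic (turanGraph n t) i).labelGraph j).copyCount _]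
  refine add_le_add (hlarge.trans ?_)
    (sum_le_sum fun j hj => (hsmall _ _ j (mem_filter.1 hj).2).le)
  refine le_of_eq_of_le ?_ (single_le_sum (fun _ _ => Nat.zero_le _) hi)
  rw [labelGraph_monochromatic, if_pos rfl]

end ColoredCount

section ColorResistant

variable {k n : ℕ} {W : Fin k → Type*} {H : ∀ i, SimpleGraph (W i)} {U : Type*} {F : SimpleGraph U}

theorem ex_le_cex (hH : ∀ j, H j ≠ ⊥) (i : Fin k) : ex n (H i) F ≤ cex n H F := by
  refine csSup_le' ?_
  rintro _ ⟨G, hG, rfl⟩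
  exact le_csSup (cexValues_finite n H F).bddAbove
    ⟨G, monochromatic G i, hG, coloredCount_monochromatic hH G i⟩

theorem isColorResistant_of_forall_coloredCount_le_monochromatic (hH : ∀ j, H j ≠ ⊥)
    {T : SimpleGraph (Fin n)} (hT : F.Free T) (i : Fin k)
    (h : ∀ (G : SimpleGraph (Fin n)) (c : G.EdgeLabeling (Fin k)), F.Free G →
      coloredCount H c ≤ coloredCount H (monochromatic T i)) :
    IsColorResistant n H F := by
  refine le_antisymm (csSup_le' ?_) (Finset.sup_le fun j _ => ex_le_cex hH j)
  rintro _ ⟨G, c, hG, rfl⟩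
  calc coloredCount H c ≤ coloredCount H (monochromatic T i) := h G c hG
    _ = T.copyCount (H i) := coloredCount_monochromatic hH T i
    _ ≤ ex n (H i) F := le_csSup (exValues_finite n (H i) F).bddAbove ⟨T, hT, rfl⟩
    _ ≤ univ.sup fun i => ex n (H i) F := le_sup (f := fun i => ex n (H i) F) (mem_univ i)

end ColorResistant

end ColoredTuran

theorem mainTheorem1 (k n m : ℕ) (hk : 1 ≤ k) (hm : 2 ≤ m) (r : Fin k → ℕ) (hr : ∀ i, 1 ≤ r i) :
    (∃ i : Fin k,
      (SimpleGraph.completeGraph (Fin m)).Free (SimpleGraph.turanGraph n (m - 1)) ∧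
      ∀ (G : SimpleGraph (Fin n)) (c : G.EdgeLabeling (Fin k)),
        (SimpleGraph.completeGraph (Fin m)).Free G →
        ColoredTuran.coloredCount (fun j => SimpleGraph.completeGraph (Fin (r j))) c ≤
          ColoredTuran.coloredCount (fun j => SimpleGraph.completeGraph (Fin (r j)))
            (ColoredTuran.monochromatic (SimpleGraph.turanGraph n (m - 1)) i)) ∧
    ((∀ i, 2 ≤ r i) →
      ColoredTuran.IsColorResistant n (fun j => SimpleGraph.completeGraph (Fin (r j)))
        (SimpleGraph.completeGraph (Fin m))) := by
  obtain ⟨t, rfl⟩ : ∃ t, m = t + 1 := Nat.exists_eq_add_of_le' (by omega)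
  have ht : 0 < t := by omega
  rw [Nat.add_sub_cancel]
  have hfree (G : SimpleGraph (Fin n)) :
      (SimpleGraph.completeGraph (Fin (t + 1))).Free G ↔ G.CliqueFree (t + 1) := by
    rw [← SimpleGraph.cliqueFree_iff_top_free, Fintype.card_fin]
  have hT := (hfree _).2 (SimpleGraph.turanGraph_cliqueFree (n := n) ht)
  obtain ⟨i, hi⟩ :=
    ColoredTuran.exists_forall_coloredCount_le_monochromatic (n := n) hk ht r
  simp only [← hfree] at hi
  refine ⟨⟨i, hT, hi⟩, fun hr₂ => ?_⟩
  have hne (j : Fin k) : SimpleGraph.completeGraph (Fin (r j)) ≠ ⊥ := by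
    have := Fin.nontrivial_iff_two_le.2 (hr₂ j)
    exact top_ne_bot
  exact ColoredTuran.isColorResistant_of_forall_coloredCount_le_monochromatic hne hT i hi
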